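/- Let $k$ be an algebraically closed field of characteristic $0$. Let $\mathscr{Z}$ be the orbit category of $(\mathbb{Z},+)$ with respect to the family of nontrivial subgroups: its objects are the $\mathbb{Z}$-sets $\mathbb{Z}/n\mathbb{Z}$ with $n\geq 1$ and its morphisms are the $\mathbb{Z}$-equivariant maps. Let $J_{at}$ be the atomic topology on $\mathscr{Z}$ (a sieve is covering if and only if it is nonempty), and let $\mathrm{Sh}(\mathscr{Z},J_{at},\underline{k})$ be the category of sheaves of $k$-modules on $(\mathscr{Z},J_{at})$. For $\xi\in k$ a primitive $n$-th root of $1$ with $n\geq 1$, let $L_\xi\subseteq k\,\mathscr{Z}(\mathbb{Z}/n\mathbb{Z},\mathbb{Z}/n\mathbb{Z})$ be the irreducible submodule on which the endomorphism $x\mapsto x+1$ of $\mathbb{Z}/n\mathbb{Z}$ acts as multiplication by $\xi$, and let $\underline{L}_\xi$ be the subpresheaf of $k\,\mathscr{Z}(-,\mathbb{Z}/n\mathbb{Z})$ generated by $L_\xi$ at $\mathbb{Z}/n\mathbb{Z}$. Then $\mathrm{Sh}(\mathscr{Z},J_{at},\underline{k})$ is a semisimple category, that is, an abelian category in which every object is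 a direct sum of simple objects. Moreover: 1. Each $\underline{L}_\xi$ is a sheaf, and it is an irreducible (simple) object of $\mathrm{Sh}(\mathscr{Z},J_{at},\underline{k})$. Every irreducible sheaf is isomorphic to $\underline{L}_\xi$ for exactly one $\xi$ among the primitive roots of unity of all orders $n\geq 1$ in $k$. 2. Every object of $\mathrm{Sh}(\mathscr{Z},J_{at},\underline{k})$ is isomorphic to a direct sum of sheaves of the form $\underline{L}_\xi$. 3. There is an equivalence of categories $$\mathrm{Sh}(\mathscr{Z},J_{at},\underline{k})\;\simeq\;\prod_{\xi} k\text{-}\mathrm{Mod},$$ the product being indexed by all primitive roots of unity $\xi$ in $k$, whose component at $\xi$ is isomorphic to the functor $\mathrm{Hom}(\underline{L}_\xi,-)$ with values in $k$-modules. -/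

import Mathlib

open CategoryTheory CategoryTheory.Limits Opposite

universe v u

noncomputable section

/-- The objects of the orbit category of an additive group `G` with respect to a family `F` of
subgroups of `G`: the object given by `H ∈ F` stands for the coset space `G ⧸ H`. -/
structure OrbitCategory (G : Type u) [AddGroup G] (F : Set (AddSubgroup G)) where
  /-- The subgroup `H` of the object `G ⧸ H`. -/
  subgroup : AddSubgroup G
  mem : subgroup ∈ F

/-- Morphisms of the orbit category are the `G`-equivariant maps `G ⧸ H → G ⧸ K`. -/
instance OrbitCategory.category (G : Type u) [AddGroup G] (F : Set (AddSubgroup G)) :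
    Category (OrbitCategory G F) where
  Hom X Y := AddActionHom (id : G → G) (G ⧸ X.subgroup) (G ⧸ Y.subgroup)
  id X := AddActionHom.id G
  comp f g := AddActionHom.comp g f

/-- The orbit category of `(ℤ, +)` with respect to the family of nontrivial subgroups. -/
abbrev IntOrbit : Type := OrbitCategory ℤ {H : AddSubgroup ℤ | H ≠ ⊥}

namespace IntOrbit

/-- The object `ℤ / nℤ`, for `n ≥ 1`. -/
def zmod (n : ℕ) (hn : 0 < n) : IntOrbit where
  subgroup := AddSubgroup.zmultiples (n : ℤ)
  mem := by
    intro h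
    rw [AddSubgroup.zmultiples_eq_bot] at h
    omega

/-- The endomorphism `x ↦ 1 + x` of the `ℤ`-set `ℤ ⧸ H`. It generates the group of all
endomorphisms of `ℤ ⧸ H`, which is cyclic of order the index of `H`. -/
def shift (X : IntOrbit) : X ⟶ X where
  toFun x := (1 : ℤ) +ᵥ x
  map_vadd' m x := by simp only [id, vadd_vadd, add_comm]

theorem hom_surjective {X Y : IntOrbit} (f : X ⟶ Y) : Function.Surjective f.toFun := by
  intro y
  obtain ⟨a, ha⟩ := AddAction.exists_vadd_eq ℤ (f.toFun ((0 : ℤ) : ℤ ⧸ X.subgroup)) y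
  exact ⟨a +ᵥ ((0 : ℤ) : ℤ ⧸ X.subgroup), (f.map_vadd' a _).trans ha⟩

/-- For `H ≤ K`, the equivariant map `ℤ ⧸ H → ℤ ⧸ K` sending the class of `0` to that of `a`. -/
def homOfLE {X Y : IntOrbit} (h : X.subgroup ≤ Y.subgroup) (a : ℤ) : X ⟶ Y where
  toFun := Quotient.map' (fun x : ℤ => x + a) (by
    intro x y hxy
    rw [QuotientAddGroup.leftRel_apply] at hxy ⊢
    have := h hxy
    convert this using 1
    ring)
  map_vadd' m x := by
    induction x using Quotient.inductionOn' with
    | h x => exact congrArg (fun z : ℤ => (z : ℤ ⧸ Y.subgroup)) (add_assoc m x a)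

theorem rightOre : GrothendieckTopology.RightOreCondition IntOrbit := by
  intro X Y Z f g
  have hW : Y.subgroup ⊓ Z.subgroup ≠ ⊥ := by
    obtain ⟨a, ha⟩ := AddSubgroup.ne_bot_iff_exists_ne_zero.1 Y.mem
    have ha0 : (a : ℤ) ≠ 0 := fun h => ha (Subtype.ext h)
    obtain ⟨b, hb⟩ := AddSubgroup.ne_bot_iff_exists_ne_zero.1 Z.mem
    have hb0 : (b : ℤ) ≠ 0 := fun h => hb (Subtype.ext h)
    intro h
    have hm : (a.1 * b.1 : ℤ) ∈ Y.subgroup ⊓ Z.subgroup := by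
      refine ⟨?_, ?_⟩
      · simpa [mul_comm] using Y.subgroup.zsmul_mem a.2 b.1
      · simpa using Z.subgroup.zsmul_mem b.2 a.1
    rw [h, AddSubgroup.mem_bot] at hm
    exact (mul_ne_zero ha0 hb0) hm
  obtain ⟨y, hy⟩ := hom_surjective f (g.toFun ((0 : ℤ) : ℤ ⧸ Z.subgroup))
  obtain ⟨a, rfl⟩ := QuotientAddGroup.mk_surjective y
  let W : IntOrbit := ⟨_, hW⟩
  let p : W ⟶ Y := homOfLE inf_le_left a
  let q : W ⟶ Z := homOfLE inf_le_right 0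
  have key : f.toFun (p.toFun ((0 : ℤ) : ℤ ⧸ W.subgroup)) =
      g.toFun (q.toFun ((0 : ℤ) : ℤ ⧸ W.subgroup)) := by
    have hp : p.toFun ((0 : ℤ) : ℤ ⧸ W.subgroup) = (a : ℤ ⧸ Y.subgroup) :=
      congrArg (fun z : ℤ => (z : ℤ ⧸ Y.subgroup)) (zero_add a)
    have hq : q.toFun ((0 : ℤ) : ℤ ⧸ W.subgroup) = ((0 : ℤ) : ℤ ⧸ Z.subgroup) :=
      congrArg (fun z : ℤ => (z : ℤ ⧸ Z.subgroup)) (zero_add 0)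
    rw [hp, hq, hy]
  refine ⟨W, p, q, ?_⟩
  refine AddActionHom.ext fun w => ?_
  obtain ⟨c, rfl⟩ := AddAction.exists_vadd_eq ℤ ((0 : ℤ) : ℤ ⧸ W.subgroup) w
  refine ((p ≫ f).map_vadd' c _).trans (Eq.trans ?_ ((q ≫ g).map_vadd' c _).symm)
  exact congrArg (fun z => id c +ᵥ z) key

/-- The atomic topology on the orbit category of `ℤ`. -/
def atomicTopology : GrothendieckTopology IntOrbit := GrothendieckTopology.atomic rightOre

/-- The category of sheaves of `k`-modules on the orbit category of `ℤ` for the atomic topology. -/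
abbrev Sh (k : Type u) [Field k] : Type (u + 1) := Sheaf atomicTopology (ModuleCat.{u} k)

instance hasSheafify (k : Type u) [Field k] :
    HasSheafify atomicTopology (ModuleCat.{u} k) := by
  have h1 : ∀ X : IntOrbit, HasColimitsOfShape (atomicTopology.Cover X)ᵒᵖ (ModuleCat.{u} k) :=
    fun X => by
      have : HasColimitsOfSize.{0, 0} (ModuleCat.{u} k) := hasColimitsOfSizeShrink.{0, 0, u, u} _
      infer_instance
  have h2 : ∀ X : IntOrbit, PreservesColimitsOfShape (atomicTopology.Cover X)ᵒᵖ
      (forget (ModuleCat.{u} k)) := fun X => by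
    have : PreservesFilteredColimitsOfSize.{0, 0} (forget (ModuleCat.{u} k)) :=
      preservesFilteredColimitsOfSize_shrink.{0, u, 0, u} _
    infer_instance
  have h3 : HasLimitsOfSize.{0, 0} (ModuleCat.{u} k) := hasLimitsOfSizeShrink.{0, 0, u, u} _
  have h4 : PreservesLimitsOfSize.{0, 0} (forget (ModuleCat.{u} k)) :=
    preservesLimitsOfSize_shrink.{0, u, 0, u} _
  infer_instance

end IntOrbit

/-- The presheaf `k C(-, X)`: its value on `Y` is the free `k`-module on the set `Y ⟶ X`. -/
def linearRepresentable (k : Type u) [Field k] {C : Type} [SmallCategory C] (X : C) :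
    Cᵒᵖ ⥤ ModuleCat.{u} k where
  obj Y := ModuleCat.of k ((unop Y ⟶ X) →₀ k)
  map f := ModuleCat.ofHom (Finsupp.lmapDomain k k fun g => f.unop ≫ g)
  map_id Y := by
    ext1
    simp only [unop_id, Category.id_comp, ModuleCat.hom_ofHom, ModuleCat.hom_id]
    exact Finsupp.lmapDomain_id k k
  map_comp f g := by
    ext1
    simp only [unop_comp, Category.assoc]
    exact Finsupp.lmapDomain_comp k k _ _

/-- The value on `Y` of the subpresheaf of `P` generated by a submodule `S` of `P(X)`: the span of
the images of `S` under the restriction maps along all morphisms `Y ⟶ X`. -/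
def generatedSubmodule {k : Type u} [Field k] {C : Type} [SmallCategory C]
    (P : Cᵒᵖ ⥤ ModuleCat.{u} k) {X : C} (S : Submodule k (P.obj (op X))) (Y : Cᵒᵖ) :
    Submodule k (P.obj Y) :=
  ⨆ f : unop Y ⟶ X, S.map (P.map f.op).hom

theorem generatedSubmodule_le_comap {k : Type u} [Field k] {C : Type} [SmallCategory C]
    (P : Cᵒᵖ ⥤ ModuleCat.{u} k) {X : C} (S : Submodule k (P.obj (op X))) {Y Z : Cᵒᵖ} (g : Y ⟶ Z) :
    generatedSubmodule P S Y ≤ (generatedSubmodule P S Z).comap (P.map g).hom := by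
  refine iSup_le fun f => ?_
  rintro _ ⟨x, hx, rfl⟩
  refine Submodule.mem_iSup_of_mem (g.unop ≫ f) ⟨x, hx, ?_⟩
  have : (g.unop ≫ f).op = f.op ≫ g := rfl
  rw [this, P.map_comp]
  rfl

/-- The subpresheaf of `P` generated by a submodule `S` of `P(X)`. -/
def generatedPresheaf {k : Type u} [Field k] {C : Type} [SmallCategory C]
    (P : Cᵒᵖ ⥤ ModuleCat.{u} k) {X : C} (S : Submodule k (P.obj (op X))) :
    Cᵒᵖ ⥤ ModuleCat.{u} k where
  obj Y := ModuleCat.of k (generatedSubmodule P S Y)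
  map g := ModuleCat.ofHom ((P.map g).hom.restrict (generatedSubmodule_le_comap P S g))
  map_id Y := by
    ext x
    change (P.map (𝟙 Y)).hom x.1 = x.1
    rw [P.map_id]
    rfl
  map_comp f g := by
    ext x
    change (P.map (f ≫ g)).hom x.1 = (P.map g).hom ((P.map f).hom x.1)
    rw [P.map_comp]
    rfl

/-- The primitive roots of unity in `k`: the elements that are a primitive `n`-th root of `1` for
some `n ≥ 1`. -/
def PrimRoot (k : Type u) [Field k] : Type u := {ξ : k // ∃ n : ℕ, 0 < n ∧ IsPrimitiveRoot ξ n}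

namespace PrimRoot

variable {k : Type u} [Field k]

/-- The unique `n ≥ 1` such that `ξ` is a primitive `n`-th root of `1`. -/
def order (ξ : PrimRoot k) : ℕ := orderOf ξ.1

theorem order_pos (ξ : PrimRoot k) : 0 < ξ.order := by
  obtain ⟨n, hn, h⟩ := ξ.2
  rw [order, ← h.eq_orderOf]
  exact hn

/-- The object `ℤ / nℤ`, where `ξ` is a primitive `n`-th root of `1`. -/
def object (ξ : PrimRoot k) : IntOrbit := IntOrbit.zmod ξ.order ξ.order_pos

/-- The irreducible `k G_n`-submodule `L_ξ` of `k Hom(ℤ/nℤ, ℤ/nℤ)`, where `ξ` is a primitive `n`-th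
root of `1` and `G_n` is the endomorphism group of `ℤ/nℤ`: the elements on which the generator
`x ↦ x + 1` of `G_n` acts as multiplication by `ξ`. -/
def eigenline (ξ : PrimRoot k) : Submodule k ((linearRepresentable k ξ.object).obj (op ξ.object)) :=
  Module.End.eigenspace ((linearRepresentable k ξ.object).map (IntOrbit.shift ξ.object).op).hom ξ.1

/-- The presheaf `L_ξ`: the subpresheaf of `k Hom(-, ℤ/nℤ)` generated by the irreducible
`k G_n`-module `L_ξ` at `ℤ/nℤ`. -/
def presheaf (ξ : PrimRoot k) : IntOrbitᵒᵖ ⥤ ModuleCat.{u} k :=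
  generatedPresheaf (linearRepresentable k ξ.object) ξ.eigenline

/-- The presheaf `L_ξ` regarded as an object of the category of sheaves. -/
abbrev sheaf (ξ : PrimRoot k) (h : Presheaf.IsSheaf IntOrbit.atomicTopology ξ.presheaf) :
    IntOrbit.Sh k := ⟨ξ.presheaf, h⟩

end PrimRoot

/-- `V` is a direct sum (coproduct) of the family of objects `S`. -/
def IsDirectSum {C : Type u} [Category.{v} C] {ι : Type v} (V : C) (S : ι → C) : Prop :=
  ∃ inj : ∀ i, S i ⟶ V, Nonempty (IsColimit (Cofan.mk V inj))

/-- An abelian category is semisimple if each of its objects is a direct sum of a family of simple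
objects. -/
def IsSemisimpleCategory (C : Type u) [Category.{v} C] [Abelian C] : Prop :=
  ∀ V : C, ∃ (ι : Type v) (S : ι → C), (∀ i, Simple (S i)) ∧ IsDirectSum V S

end

/-!
A sheaf `F` for the atomic topology is determined by the action of the shift `x ↦ x + 1` on the
modules `F(ℤ/H)`: every morphism of orbits is of the form `x ↦ x + a`, and by
`IntOrbit.isSheaf_iff` the sheaf condition says that for `H ≤ K` the restriction
`F(ℤ/K) → F(ℤ/H)` is injective with image the elements fixed by `K`. The shift on `F(ℤ/mℤ)` has
order dividing `m`, so over an algebraically closed field of characteristic `0` it is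
diagonalizable with `m`-th roots of unity as eigenvalues. If `ξ` has order `n`, then `n ∣ m`, and
its eigenspace in `F(ℤ/mℤ)` restricts isomorphically from the eigenspace `F(ℤ/nℤ)_ξ`, called the
`ξ`-component of `F`. Hence `F(ℤ/mℤ)` is the direct sum of the `ξ`-components over the roots of
unity with `ξ ^ m = 1`.

Conversely, a family of modules `V ξ` gives a sheaf, whose value on `ℤ/H` is the part of `⨁ V ξ`
fixed by `H`, where `x ↦ x + a` acts on `V ξ` as `ξ ^ a`. These constructions are inverse to each
other (`IntOrbit.componentsEquivalence`).

The line `L_ξ` is spanned by `∑ ξ⁻ʲ [x ↦ x + j]`, and by the Yoneda lemma evaluation at this element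
identifies `Hom(L_ξ, F)` with the `ξ`-component of `F` (`PrimRoot.componentFunctorIso`). The sheaves
`L_ξ` are pairwise orthogonal and have only scalar endomorphisms. The remaining assertions are
formal: in a linear category that is a product of categories of modules by means of the functors
`Hom(L i, -)`, with such `L i`, bases of the spaces `Hom(L i, V)` exhibit `V` as a direct sum of
copies of the `L i`, and the `L i` are, up to isomorphism, the simple objects.
-/

noncomputable section

namespace IntOrbit

/-! ### Morphisms of the orbit category -/

theorem homOfLE_toFun {X Y : IntOrbit} (h : X.subgroup ≤ Y.subgroup) (a x : ℤ) :
    (homOfLE h a).toFun (x : ℤ ⧸ X.subgroup) = ((x + a : ℤ) : ℤ ⧸ Y.subgroup) :=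
  rfl

theorem hom_ext_zero {X Y : IntOrbit} {f g : X ⟶ Y}
    (h : f.toFun ((0 : ℤ) : ℤ ⧸ X.subgroup) = g.toFun ((0 : ℤ) : ℤ ⧸ X.subgroup)) : f = g := by
  refine AddActionHom.ext fun w => ?_
  obtain ⟨c, rfl⟩ := AddAction.exists_vadd_eq ℤ ((0 : ℤ) : ℤ ⧸ X.subgroup) w
  exact (f.map_vadd' c _).trans ((congrArg (fun z => id c +ᵥ z) h).trans (g.map_vadd' c _).symm)

theorem homOfLE_eq_iff {X Y : IntOrbit} (h : X.subgroup ≤ Y.subgroup) {a b : ℤ} :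
    homOfLE h a = homOfLE h b ↔ b - a ∈ Y.subgroup := by
  have key : b - a ∈ Y.subgroup ↔ ((a : ℤ ⧸ Y.subgroup) = (b : ℤ ⧸ Y.subgroup)) := by
    rw [QuotientAddGroup.eq, neg_add_eq_sub]
  rw [key]
  constructor
  · intro hab
    have := congrArg (fun f : X ⟶ Y => f.toFun ((0 : ℤ) : ℤ ⧸ X.subgroup)) hab
    simpa only [homOfLE_toFun, zero_add] using this
  · intro hab
    apply hom_ext_zero
    simpa only [homOfLE_toFun, zero_add] using hab

theorem le_of_hom {X Y : IntOrbit} (f : X ⟶ Y) : X.subgroup ≤ Y.subgroup := by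
  intro c hc
  obtain ⟨a, ha⟩ := QuotientAddGroup.mk_surjective (f.toFun ((0 : ℤ) : ℤ ⧸ X.subgroup))
  have h1 := f.map_vadd' c ((0 : ℤ) : ℤ ⧸ X.subgroup)
  have h2 : c +ᵥ ((0 : ℤ) : ℤ ⧸ X.subgroup) = ((0 : ℤ) : ℤ ⧸ X.subgroup) := by
    change ((c + 0 : ℤ) : ℤ ⧸ X.subgroup) = _
    rw [QuotientAddGroup.eq]
    simpa using hc
  rw [h2, ← ha] at h1
  change (a : ℤ ⧸ Y.subgroup) = ((c + a : ℤ) : ℤ ⧸ Y.subgroup) at h1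
  rw [QuotientAddGroup.eq] at h1
  simpa using h1

/-- An integer `a` such that `f` maps the class of `0` to the class of `a`. -/
def offset {X Y : IntOrbit} (f : X ⟶ Y) : ℤ :=
  (QuotientAddGroup.mk_surjective (f.toFun ((0 : ℤ) : ℤ ⧸ X.subgroup))).choose

theorem homOfLE_offset {X Y : IntOrbit} (f : X ⟶ Y) : homOfLE (le_of_hom f) (offset f) = f := by
  apply hom_ext_zero
  rw [homOfLE_toFun, zero_add]
  exact (QuotientAddGroup.mk_surjective (f.toFun ((0 : ℤ) : ℤ ⧸ X.subgroup))).choose_spec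

theorem homOfLE_comp {X Y Z : IntOrbit} (h : X.subgroup ≤ Y.subgroup)
    (h' : Y.subgroup ≤ Z.subgroup) (a b : ℤ) :
    homOfLE h a ≫ homOfLE h' b = homOfLE (h.trans h') (a + b) := by
  apply hom_ext_zero
  change ((0 + a + b : ℤ) : ℤ ⧸ Z.subgroup) = ((0 + (a + b) : ℤ) : ℤ ⧸ Z.subgroup)
  rw [add_assoc]

theorem homOfLE_zero (X : IntOrbit) : homOfLE (le_refl X.subgroup) 0 = 𝟙 X := by
  apply hom_ext_zero
  rfl

theorem homOfLE_one (X : IntOrbit) : homOfLE (le_refl X.subgroup) 1 = shift X := by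
  apply hom_ext_zero
  rfl

theorem exists_subgroup_eq (X : IntOrbit) :
    ∃ m : ℕ, 0 < m ∧ X.subgroup = AddSubgroup.zmultiples (m : ℤ) := by
  obtain ⟨a, ha⟩ := Int.subgroup_cyclic X.subgroup
  rw [← AddSubgroup.zmultiples_eq_closure] at ha
  refine ⟨a.natAbs, ?_, ?_⟩
  · rw [Int.natAbs_pos]
    rintro rfl
    exact X.mem (by simp [ha])
  · rw [ha, Int.zmultiples_natAbs]

/-! ### Presheaves on the orbit category -/

variable {k : Type u} [Field k]

/-- The restriction map of the presheaf `F` along `x ↦ x + a`. Every restriction map of `F` has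
this form. -/
def act (F : IntOrbitᵒᵖ ⥤ ModuleCat.{u} k) {X Y : IntOrbit} (h : X.subgroup ≤ Y.subgroup) (a : ℤ) :
    F.obj (op Y) →ₗ[k] F.obj (op X) :=
  (F.map (homOfLE h a).op).hom

section

variable (F : IntOrbitᵒᵖ ⥤ ModuleCat.{u} k) {X Y Z : IntOrbit}

theorem act_act (h : X.subgroup ≤ Y.subgroup) (h' : Y.subgroup ≤ Z.subgroup) (a b : ℤ)
    (x : F.obj (op Z)) : act F h a (act F h' b x) = act F (h.trans h') (a + b) x := by
  unfold act
  rw [← homOfLE_comp h h', op_comp, F.map_comp]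
  rfl

theorem act_zero (x : F.obj (op X)) : act F (le_refl X.subgroup) 0 x = x := by
  unfold act
  rw [homOfLE_zero, op_id, F.map_id]
  rfl

theorem act_congr (h : X.subgroup ≤ Y.subgroup) {a b : ℤ} (hab : b - a ∈ Y.subgroup) :
    act F h a = act F h b := by
  unfold act
  rw [(homOfLE_eq_iff h).2 hab]

theorem map_eq_act {X Y : IntOrbit} (f : X ⟶ Y) (x : F.obj (op Y)) :
    (F.map f.op).hom x = act F (le_of_hom f) (offset f) x := by
  unfold act
  rw [homOfLE_offset]

theorem act_one : act F (le_refl X.subgroup) 1 = (F.map (shift X).op).hom := by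
  unfold act
  rw [homOfLE_one]

variable {F} {G : IntOrbitᵒᵖ ⥤ ModuleCat.{u} k}

theorem app_act (φ : F ⟶ G) (h : X.subgroup ≤ Y.subgroup) (a : ℤ) (x : F.obj (op Y)) :
    (φ.app (op X)).hom (act F h a x) = act G h a ((φ.app (op Y)).hom x) :=
  congrArg (fun g => g.hom x) (φ.naturality (homOfLE h a).op)

/-- A family of linear maps that commutes with the maps `act` is a morphism of presheaves. -/
def homOfAct (φ : ∀ X : IntOrbit, F.obj (op X) →ₗ[k] G.obj (op X))
    (hφ : ∀ (X Y : IntOrbit) (h : X.subgroup ≤ Y.subgroup) (a : ℤ) (x : F.obj (op Y)),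
      φ X (act F h a x) = act G h a (φ Y x)) : F ⟶ G where
  app X := ModuleCat.ofHom (φ (unop X))
  naturality {X Y} f := by
    ext x
    change φ (unop Y) ((F.map f.unop.op).hom x) = (G.map f.unop.op).hom (φ (unop X) x)
    rw [map_eq_act, map_eq_act, hφ]

end

/-! ### The sheaf condition -/

theorem act_injective (F : IntOrbitᵒᵖ ⥤ ModuleCat.{u} k) {X Y : IntOrbit}
    (h : X.subgroup ≤ Y.subgroup) (h0 : Function.Injective (act F h 0)) (a : ℤ) :
    Function.Injective (act F h a) := by
  intro x y hxy
  have h1 : act F (le_refl Y.subgroup) a x = act F (le_refl Y.subgroup) a y := by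
    apply h0
    rw [act_act, act_act, zero_add, hxy]
  have h2 := congrArg (act F (le_refl Y.subgroup) (-a)) h1
  rwa [act_act, act_act, neg_add_cancel, act_zero, act_zero] at h2

theorem isSheaf_iff_types (F : IntOrbitᵒᵖ ⥤ ModuleCat.{u} k) :
    Presheaf.IsSheaf atomicTopology F ↔
      Presieve.IsSheaf atomicTopology (F ⋙ forget (ModuleCat.{u} k)) := by
  have : HasLimitsOfSize.{0, 0} (ModuleCat.{u} k) := hasLimitsOfSizeShrink.{0, 0, u, u} _
  have : PreservesLimitsOfSize.{0, 0} (forget (ModuleCat.{u} k)) :=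
    preservesLimitsOfSize_shrink.{0, u, 0, u} _
  rw [Presheaf.isSheaf_iff_isSheaf_comp atomicTopology F (forget (ModuleCat.{u} k)),
    isSheaf_iff_isSheaf_of_type]

/-- A presheaf is a sheaf for the atomic topology if and only if, for `H ≤ K`, it identifies
`F(ℤ/K)` with the elements of `F(ℤ/H)` that are fixed by `K`. -/
theorem isSheaf_iff (F : IntOrbitᵒᵖ ⥤ ModuleCat.{u} k) :
    Presheaf.IsSheaf atomicTopology F ↔
      ∀ (X Y : IntOrbit) (h : X.subgroup ≤ Y.subgroup), Function.Injective (act F h 0) ∧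
        ∀ w : F.obj (op X), (∀ c ∈ Y.subgroup, act F (le_refl X.subgroup) c w = w) →
          ∃ y, act F h 0 y = w := by
  rw [isSheaf_iff_types]
  constructor
  · intro hF X Y h
    have hS : Sieve.generate (Presieve.singleton (homOfLE h 0)) ∈ atomicTopology Y :=
      ⟨X, homOfLE h 0, Sieve.le_generate _ _ _ (Presieve.singleton_self _)⟩
    have h1 := (Presieve.isSheafFor_iff_generate _).2 (hF _ hS)
    refine ⟨Presieve.isSeparatedFor_singleton.1 h1.isSeparatedFor, fun w hw => ?_⟩
    refine (Presieve.isSheafFor_singleton.1 h1 w fun {Z} p q hpq => ?_).exists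
    change (F.map p.op).hom w = (F.map q.op).hom w
    rw [← homOfLE_offset p, ← homOfLE_offset q, homOfLE_comp, homOfLE_comp, homOfLE_eq_iff,
      add_zero, add_zero] at hpq
    rw [map_eq_act, map_eq_act]
    conv_lhs => rw [← hw _ hpq]
    rw [act_act, add_sub_cancel]
  · intro H Y S hS
    obtain ⟨X, f, hf⟩ := hS
    have hinj : ∀ {X Y : IntOrbit} (f : X ⟶ Y) {x y : F.obj (op Y)},
        (F.map f.op).hom x = (F.map f.op).hom y → x = y := by
      intro X Y f x y hxy
      rw [map_eq_act, map_eq_act] at hxy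
      exact act_injective F (le_of_hom f) ((H X Y (le_of_hom f)).1) _ hxy
    have hcomp : ∀ {X Y Z : IntOrbit} (f : X ⟶ Y) (g : Y ⟶ Z) (x : F.obj (op Z)),
        (F.map (f ≫ g).op).hom x = (F.map f.op).hom ((F.map g.op).hom x) := by
      intro X Y Z f g x
      rw [op_comp, F.map_comp]
      rfl
    intro x hx
    have hdesc : ∃ y : F.obj (op Y), (F.map f.op).hom y = x f hf := by
      have hle := le_of_hom f
      obtain ⟨y, hy⟩ := (H X Y hle).2 (x f hf) fun c hc => by
        have hcf : homOfLE (le_refl X.subgroup) c ≫ f = 𝟙 X ≫ f := by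
          rw [Category.id_comp, ← homOfLE_offset f, homOfLE_comp, homOfLE_eq_iff]
          simpa using hc
        have h2 := hx _ _ hf hf hcf
        change (F.map (homOfLE (le_refl X.subgroup) c).op).hom (x f hf) =
          (F.map (𝟙 X).op).hom (x f hf) at h2
        rwa [op_id, F.map_id] at h2
      -- `y` restricts to `x f` along `x ↦ x`; translate it to the given `f`.
      refine ⟨act F (le_refl Y.subgroup) (-offset f) y, ?_⟩
      rw [map_eq_act, act_act, add_neg_cancel]
      exact hy
    obtain ⟨y, hy⟩ := hdesc
    refine ⟨y, fun Z g hg => ?_, fun z hz => ?_⟩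
    · obtain ⟨W, p, q, hpq⟩ := rightOre g f
      refine hinj p (Eq.trans (hcomp p g y).symm ?_)
      rw [hpq, hcomp q f y, hy]
      exact (hx _ _ hg hf hpq).symm
    · exact hinj f ((hz f hf).trans hy.symm)

end IntOrbit

theorem sum_range_succ_eq_of_periodic {M : Type*} [AddCancelCommMonoid M] {g : ℕ → M} {m : ℕ}
    (h : g m = g 0) : ∑ j ∈ Finset.range m, g (j + 1) = ∑ j ∈ Finset.range m, g j := by
  have h1 := Finset.sum_range_succ g m
  rw [Finset.sum_range_succ', h] at h1
  exact add_right_cancel h1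

namespace PrimRoot

open IntOrbit

variable {k : Type u} [Field k]

/-! ### The presheaves `L_ξ` -/

/-- The root of unity `ξ` as an element of `k`. -/
def root (ξ : PrimRoot k) : k := ξ.1

theorem root_pow_order (ξ : PrimRoot k) : ξ.root ^ ξ.order = 1 := pow_orderOf_eq_one ξ.1

theorem ne_zero (ξ : PrimRoot k) : ξ.root ≠ 0 := by
  obtain ⟨n, hn, h⟩ := ξ.2
  exact h.ne_zero hn.ne'

theorem mem_object_iff (ξ : PrimRoot k) (a : ℤ) : a ∈ ξ.object.subgroup ↔ ξ.root ^ a = 1 := by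
  rw [(IsPrimitiveRoot.orderOf ξ.root).zpow_eq_one_iff_dvd]
  exact Int.mem_zmultiples_iff

/-- The `ξ`-component of a presheaf `F`: the elements of `F(ℤ/nℤ)`, with `n` the order of `ξ`, on
which `x ↦ x + 1` acts as multiplication by `ξ`. -/
def component (ξ : PrimRoot k) (F : IntOrbitᵒᵖ ⥤ ModuleCat.{u} k) :
    Submodule k (F.obj (op ξ.object)) :=
  Module.End.eigenspace (act F (le_refl ξ.object.subgroup) 1) ξ.root

end PrimRoot

namespace IntOrbit

open PrimRoot

variable {k : Type u} [Field k]

theorem act_eigenvector (F : IntOrbitᵒᵖ ⥤ ModuleCat.{u} k) {X : IntOrbit} {c : k} (hc : c ≠ 0)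
    {x : F.obj (op X)} (hx : act F (le_refl X.subgroup) 1 x = c • x) (a : ℤ) :
    act F (le_refl X.subgroup) a x = c ^ a • x := by
  have hneg : act F (le_refl X.subgroup) (-1) x = c⁻¹ • x := by
    rw [eq_inv_smul_iff₀ hc, ← map_smul, ← hx, act_act, neg_add_cancel, act_zero]
  induction a using Int.induction_on with
  | zero => rw [act_zero, zpow_zero, one_smul]
  | succ i ih =>
    rw [← act_act F (le_refl X.subgroup) (le_refl X.subgroup), hx, map_smul, ih, smul_smul,
      zpow_add_one₀ hc, mul_comm]
  | pred i ih =>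
    rw [sub_eq_add_neg, ← act_act F (le_refl X.subgroup) (le_refl X.subgroup), hneg, map_smul, ih,
      smul_smul, ← sub_eq_add_neg, zpow_sub_one₀ hc, mul_comm]

/-- If a subgroup fixes an eigenvector of the shift with eigenvalue `ξ` of order `n`, then it is
contained in `nℤ`. -/
theorem le_object_of_eigenvector (F : IntOrbitᵒᵖ ⥤ ModuleCat.{u} k) {X Y : IntOrbit}
    (ξ : PrimRoot k) {x : F.obj (op X)} (hx0 : x ≠ 0)
    (hx : act F (le_refl X.subgroup) 1 x = ξ.root • x)
    (hinv : ∀ c ∈ Y.subgroup, act F (le_refl X.subgroup) c x = x) :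
    Y.subgroup ≤ ξ.object.subgroup := by
  intro c hc
  rw [mem_object_iff]
  have h1 := act_eigenvector F ξ.ne_zero hx c
  rw [hinv c hc] at h1
  have h2 : (ξ.root ^ c - 1) • x = 0 := by rw [sub_smul, one_smul, ← h1, sub_self]
  exact sub_eq_zero.1 ((smul_eq_zero.1 h2).resolve_right hx0)

theorem act_self (F : IntOrbitᵒᵖ ⥤ ModuleCat.{u} k) {X : IntOrbit} {c : ℤ} (hc : c ∈ X.subgroup)
    (x : F.obj (op X)) : act F (le_refl X.subgroup) c x = x := by
  rw [act_congr F (le_refl X.subgroup) (a := c) (b := 0) (by simpa using hc), act_zero]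

theorem act_linearRepresentable_injective (Z : IntOrbit) {X Y : IntOrbit}
    (h : X.subgroup ≤ Y.subgroup) (a : ℤ) :
    Function.Injective (act (linearRepresentable k Z) h a) := by
  refine Finsupp.mapDomain_injective fun f g hfg => ?_
  refine AddActionHom.ext fun y => ?_
  obtain ⟨x, rfl⟩ := hom_surjective (homOfLE h a) y
  exact congrArg (fun q : X ⟶ Z => q.toFun x) hfg

end IntOrbit

namespace PrimRoot

open IntOrbit

variable {k : Type u} [Field k] (ξ : PrimRoot k)

theorem act_presheaf_val {X Y : IntOrbit} (h : X.subgroup ≤ Y.subgroup) (a : ℤ)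
    (x : ξ.presheaf.obj (op Y)) :
    (act ξ.presheaf h a x).1 = act (linearRepresentable k ξ.object) h a x.1 :=
  rfl

theorem mem_eigenline_iff (x : (linearRepresentable k ξ.object).obj (op ξ.object)) :
    x ∈ ξ.eigenline ↔
      act (linearRepresentable k ξ.object) (le_refl ξ.object.subgroup) 1 x = ξ.root • x := by
  rw [eigenline, Module.End.mem_eigenspace_iff, act_one]
  rfl

/-- The shift acts as `ξ` on all of `L_ξ`, since it commutes with the restriction maps. -/
theorem act_one_presheaf (X : IntOrbit) (x : ξ.presheaf.obj (op X)) :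
    act ξ.presheaf (le_refl X.subgroup) 1 x = ξ.root • x := by
  apply Subtype.ext
  rw [act_presheaf_val]
  change _ = ξ.root • x.1
  have hle : generatedSubmodule (linearRepresentable k ξ.object) ξ.eigenline (op X) ≤
      Module.End.eigenspace
        (act (linearRepresentable k ξ.object) (le_refl X.subgroup) 1) ξ.root := by
    refine iSup_le fun f => ?_
    rintro _ ⟨y, hy, rfl⟩
    rw [SetLike.mem_coe, mem_eigenline_iff] at hy
    rw [Module.End.mem_eigenspace_iff, map_eq_act, act_act, ← map_smul, ← hy, act_act, add_comm]
  exact Module.End.mem_eigenspace_iff.1 (hle x.2)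

theorem isSheaf_presheaf : Presheaf.IsSheaf atomicTopology ξ.presheaf := by
  rw [isSheaf_iff]
  intro X Y h
  refine ⟨fun x y hxy => Subtype.ext ?_, fun w hw => ?_⟩
  · exact act_linearRepresentable_injective ξ.object h 0 (congrArg Subtype.val hxy)
  · by_cases hw0 : w = 0
    · exact ⟨0, by rw [hw0, map_zero]⟩
    have hY := le_object_of_eigenvector ξ.presheaf ξ hw0 (ξ.act_one_presheaf X w) hw
    -- Every map `ℤ/H → ℤ/nℤ` factors through `ℤ/H → ℤ/K`, so the generators restrict from `ℤ/K`.
    have hle : generatedSubmodule (linearRepresentable k ξ.object) ξ.eigenline (op X) ≤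
        (generatedSubmodule (linearRepresentable k ξ.object) ξ.eigenline (op Y)).map
          (act (linearRepresentable k ξ.object) h 0) := by
      refine iSup_le fun f => ?_
      rintro _ ⟨y, hy, rfl⟩
      refine ⟨act _ hY (offset f) y, ?_, ?_⟩
      · exact Submodule.mem_iSup_of_mem (homOfLE hY (offset f)) ⟨y, hy, rfl⟩
      · rw [act_act, zero_add]
        exact (map_eq_act _ f y).symm
    obtain ⟨y, hy, hyw⟩ := hle w.2
    exact ⟨⟨y, hy⟩, Subtype.ext hyw⟩

theorem eigenline_apply_shift {x : (linearRepresentable k ξ.object).obj (op ξ.object)}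
    (hx : x ∈ ξ.eigenline) (a : ℤ) (φ : ξ.object ⟶ ξ.object) :
    (show (ξ.object ⟶ ξ.object) →₀ k from x) φ = ξ.root ^ a *
      (show (ξ.object ⟶ ξ.object) →₀ k from x) (homOfLE (le_refl _) a ≫ φ) := by
  have h1 := act_eigenvector _ ξ.ne_zero ((ξ.mem_eigenline_iff x).1 hx) a
  have hinj : Function.Injective
      (fun ψ : ξ.object ⟶ ξ.object => homOfLE (le_refl ξ.object.subgroup) a ≫ ψ) := by
    intro f g hfg
    have h2 := congrArg (homOfLE (le_refl ξ.object.subgroup) (-a) ≫ ·) hfg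
    simpa only [← Category.assoc, homOfLE_comp, neg_add_cancel, homOfLE_zero,
      Category.id_comp] using h2
  have h3 := Finsupp.mapDomain_apply hinj (show (ξ.object ⟶ ξ.object) →₀ k from x) φ
  rw [← h3]
  exact congrArg (fun y : (ξ.object ⟶ ξ.object) →₀ k => y (homOfLE (le_refl _) a ≫ φ)) h1

/-- The translations act transitively on the endomorphisms of `ℤ/nℤ`, so an element of `L_ξ` is
determined by its coefficient at the identity. -/
theorem eigenline_ext {x y : (linearRepresentable k ξ.object).obj (op ξ.object)}
    (hx : x ∈ ξ.eigenline) (hy : y ∈ ξ.eigenline)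
    (h : (show (ξ.object ⟶ ξ.object) →₀ k from x) (𝟙 _) =
      (show (ξ.object ⟶ ξ.object) →₀ k from y) (𝟙 _)) : x = y := by
  refine Finsupp.ext (M := k) fun φ => ?_
  have hφ : homOfLE (le_refl ξ.object.subgroup) (-offset φ) ≫ φ = 𝟙 _ := by
    refine (congrArg _ (homOfLE_offset φ).symm).trans ?_
    rw [homOfLE_comp, neg_add_cancel, homOfLE_zero]
  have h1 := ξ.eigenline_apply_shift hx (-offset φ) φ
  have h2 := ξ.eigenline_apply_shift hy (-offset φ) φ
  rw [hφ] at h1 h2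
  exact h1.trans ((congrArg _ h).trans h2.symm)

theorem act_single {Z X Y : IntOrbit} (h : X.subgroup ≤ Y.subgroup) (a : ℤ) (f : Y ⟶ Z) (c : k) :
    act (linearRepresentable k Z) h a (Finsupp.single f c : (Y ⟶ Z) →₀ k) =
      (Finsupp.single (homOfLE h a ≫ f) c : (X ⟶ Z) →₀ k) :=
  Finsupp.mapDomain_single

/-- The element `ξ⁻ʲ [x ↦ x + j]` of `k Hom(ℤ/nℤ, ℤ/nℤ)`. -/
def twist (j : ℕ) : (linearRepresentable k ξ.object).obj (op ξ.object) :=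
  (Finsupp.single (homOfLE (le_refl ξ.object.subgroup) j) (ξ.root ^ j)⁻¹ :
    (ξ.object ⟶ ξ.object) →₀ k)

/-- The generator `∑ ξ⁻ʲ [x ↦ x + j]`, for `0 ≤ j < n`, of the line `L_ξ`. -/
def generator : (linearRepresentable k ξ.object).obj (op ξ.object) :=
  ∑ j ∈ Finset.range ξ.order, ξ.twist j

theorem smul_single {Z X : IntOrbit} (f : X ⟶ Z) (b c : k) :
    b • (show (linearRepresentable k Z).obj (op X) from
      (Finsupp.single f c : (X ⟶ Z) →₀ k)) =
      (Finsupp.single f (b * c) : (X ⟶ Z) →₀ k) :=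
  Finsupp.smul_single' b f c

theorem act_twist (j : ℕ) :
    act (linearRepresentable k ξ.object) (le_refl ξ.object.subgroup) 1 (ξ.twist j) =
      ξ.root • ξ.twist (j + 1) := by
  refine (act_single _ _ _ _).trans (Eq.trans ?_ (smul_single _ _ _).symm)
  rw [homOfLE_comp, pow_succ, mul_inv, mul_comm ξ.root, mul_assoc,
    inv_mul_cancel₀ ξ.ne_zero, mul_one, add_comm (1 : ℤ), Nat.cast_succ]

theorem generator_mem : ξ.generator ∈ ξ.eigenline := by
  have h0 : ξ.twist ξ.order = ξ.twist 0 := by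
    have h2 : homOfLE (le_refl ξ.object.subgroup) (ξ.order : ℤ) =
        homOfLE (le_refl ξ.object.subgroup) ((0 : ℕ) : ℤ) := by
      rw [homOfLE_eq_iff, mem_object_iff]
      simp [ξ.root_pow_order]
    rw [twist, h2, ξ.root_pow_order, ← pow_zero ξ.root]
    rfl
  have hsum : ∑ j ∈ Finset.range ξ.order, ξ.twist (j + 1) = ξ.generator := by
    exact sum_range_succ_eq_of_periodic h0
  rw [mem_eigenline_iff]
  conv_lhs => rw [generator, map_sum, Finset.sum_congr rfl fun j _ => ξ.act_twist j,
    ← Finset.smul_sum, hsum]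

theorem generator_apply_id :
    (show (ξ.object ⟶ ξ.object) →₀ k from ξ.generator) (𝟙 _) = 1 := by
  change (∑ j ∈ Finset.range ξ.order, (Finsupp.single (homOfLE (le_refl ξ.object.subgroup) j)
    (ξ.root ^ j)⁻¹ : (ξ.object ⟶ ξ.object) →₀ k)) _ = 1
  rw [Finsupp.finsetSum_apply, Finset.sum_eq_single 0]
  · simp [homOfLE_zero]
  · intro j hj hj0
    rw [Finsupp.single_eq_of_ne]
    rw [← homOfLE_zero, ne_comm, Ne, homOfLE_eq_iff, zero_sub, neg_mem_iff, mem_object_iff,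
      zpow_natCast]
    intro h
    exact hj0 (Nat.eq_zero_of_dvd_of_lt (orderOf_dvd_of_pow_eq_one h) (Finset.mem_range.1 hj))
  · intro h
    exact absurd (Finset.mem_range.2 ξ.order_pos) h

theorem exists_smul_generator {x : (linearRepresentable k ξ.object).obj (op ξ.object)}
    (hx : x ∈ ξ.eigenline) : ∃ c : k, x = c • ξ.generator := by
  refine ⟨(show (ξ.object ⟶ ξ.object) →₀ k from x) (𝟙 _),
    ξ.eigenline_ext hx (Submodule.smul_mem _ _ ξ.generator_mem) ?_⟩
  change _ = _ * (show (ξ.object ⟶ ξ.object) →₀ k from ξ.generator) (𝟙 _)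
  rw [generator_apply_id, mul_one]

theorem eigenline_le_generatedSubmodule :
    ξ.eigenline ≤
      generatedSubmodule (linearRepresentable k ξ.object) ξ.eigenline (op ξ.object) := by
  intro x hx
  refine Submodule.mem_iSup_of_mem (𝟙 _) ⟨x, hx, ?_⟩
  rw [op_id, CategoryTheory.Functor.map_id]
  rfl

end PrimRoot

/-! ### Morphisms out of `L_ξ` -/

/-- The morphism `k C(-, Z) ⟶ F` that the Yoneda lemma attaches to an element of `F(Z)`. -/
def linearRepresentableDesc {k : Type u} [Field k] {C : Type} [SmallCategory C] {Z : C}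
    (F : Cᵒᵖ ⥤ ModuleCat.{u} k) (v : F.obj (op Z)) : linearRepresentable k Z ⟶ F where
  app X := ModuleCat.ofHom
    (Finsupp.linearCombination k fun f : unop X ⟶ Z => (F.map f.op).hom v)
  naturality X Y g := by
    ext1
    refine Finsupp.lhom_ext fun f c => ?_
    change Finsupp.linearCombination k _ (Finsupp.mapDomain _ (Finsupp.single f c)) =
      (F.map g).hom (Finsupp.linearCombination k _ (Finsupp.single f c))
    rw [Finsupp.mapDomain_single, Finsupp.linearCombination_single,
      Finsupp.linearCombination_single, map_smul, op_comp, F.map_comp]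
    rfl

namespace PrimRoot

open IntOrbit

variable {k : Type u} [Field k] (ξ : PrimRoot k)

theorem mem_component_iff (F : IntOrbitᵒᵖ ⥤ ModuleCat.{u} k) (x : F.obj (op ξ.object)) :
    x ∈ ξ.component F ↔ act F (le_refl ξ.object.subgroup) 1 x = ξ.root • x :=
  Module.End.mem_eigenspace_iff

theorem app_mem_component {F G : IntOrbitᵒᵖ ⥤ ModuleCat.{u} k} (φ : F ⟶ G)
    {x : F.obj (op ξ.object)} (hx : x ∈ ξ.component F) :
    (φ.app (op ξ.object)).hom x ∈ ξ.component G := by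
  rw [mem_component_iff] at hx ⊢
  rw [← app_act, hx, map_smul]

/-- The functor `F ↦ F(ℤ/nℤ)_ξ` on sheaves. -/
def componentFunctor : Sh k ⥤ ModuleCat.{u} k where
  obj F := ModuleCat.of k (ξ.component F.obj)
  map φ := ModuleCat.ofHom ((φ.hom.app (op ξ.object)).hom.restrict
    fun _ hx => ξ.app_mem_component φ.hom hx)

/-- `L_ξ` as a sheaf. -/
abbrev line : Sh k := ξ.sheaf ξ.isSheaf_presheaf

/-- The generator of `L_ξ` as an element of `L_ξ(ℤ/nℤ)`. -/
def lineGenerator : ξ.presheaf.obj (op ξ.object) :=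
  ⟨ξ.generator, ξ.eigenline_le_generatedSubmodule ξ.generator_mem⟩

theorem lineGenerator_mem : ξ.lineGenerator ∈ ξ.component ξ.presheaf :=
  (ξ.mem_component_iff _ _).2 (ξ.act_one_presheaf _ _)

/-- `L_ξ` is generated by its generator, so a morphism out of it is determined by one value. -/
theorem presheaf_hom_ext {F : IntOrbitᵒᵖ ⥤ ModuleCat.{u} k} {φ ψ : ξ.presheaf ⟶ F}
    (h : (φ.app (op ξ.object)).hom ξ.lineGenerator = (ψ.app (op ξ.object)).hom ξ.lineGenerator) :
    φ = ψ := by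
  ext X x
  have hle : generatedSubmodule (linearRepresentable k ξ.object) ξ.eigenline X ≤
      (LinearMap.eqLocus (φ.app X).hom (ψ.app X).hom).map
        (generatedSubmodule (linearRepresentable k ξ.object) ξ.eigenline X).subtype := by
    refine iSup_le fun f => ?_
    rintro _ ⟨y, hy, rfl⟩
    obtain ⟨c, rfl⟩ := ξ.exists_smul_generator hy
    refine ⟨(ξ.presheaf.map f.op).hom (c • ξ.lineGenerator), ?_, rfl⟩
    change (φ.app X).hom _ = (ψ.app X).hom _
    have h1 := congrArg (fun g => g.hom (c • ξ.lineGenerator)) (φ.naturality f.op)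
    have h2 := congrArg (fun g => g.hom (c • ξ.lineGenerator)) (ψ.naturality f.op)
    refine h1.trans (Eq.trans ?_ h2.symm)
    change (F.map f.op).hom ((φ.app _).hom _) = (F.map f.op).hom ((ψ.app _).hom _)
    exact congrArg _ ((map_smul _ _ _).trans ((congrArg _ h).trans (map_smul _ _ _).symm))
  obtain ⟨y, hy, hyx⟩ := hle x.2
  have : y = x := Subtype.ext hyx
  rw [← this]
  exact hy

/-- The morphism `L_ξ ⟶ F` obtained by restricting to `L_ξ` the morphism
`k Hom(-, ℤ/nℤ) ⟶ F` attached to an element of `F(ℤ/nℤ)`. -/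
def presheafDesc (F : IntOrbitᵒᵖ ⥤ ModuleCat.{u} k) (v : F.obj (op ξ.object)) :
    ξ.presheaf ⟶ F where
  app X := ModuleCat.ofHom (((linearRepresentableDesc F v).app X).hom ∘ₗ
    (generatedSubmodule (linearRepresentable k ξ.object) ξ.eigenline X).subtype)
  naturality X Y g := by
    ext x
    exact congrArg (fun q => q.hom x.1) ((linearRepresentableDesc F v).naturality g)

/-- Each of the `n` terms `ξ⁻ʲ [x ↦ x + j]` of the generator is sent to `v`. -/
theorem presheafDesc_lineGenerator {F : IntOrbitᵒᵖ ⥤ ModuleCat.{u} k} {v : F.obj (op ξ.object)}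
    (hv : v ∈ ξ.component F) :
    ((ξ.presheafDesc F v).app (op ξ.object)).hom ξ.lineGenerator = (ξ.order : k) • v := by
  change ((linearRepresentableDesc F v).app (op ξ.object)).hom ξ.generator = _
  have h1 : ∀ j : ℕ, ((linearRepresentableDesc F v).app (op ξ.object)).hom (ξ.twist j) = v := by
    intro j
    refine (Finsupp.linearCombination_single k _ _).trans ?_
    change (ξ.root ^ j)⁻¹ • act F (le_refl ξ.object.subgroup) j v = v
    rw [act_eigenvector F ξ.ne_zero ((ξ.mem_component_iff F v).1 hv), zpow_natCast, smul_smul,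
      inv_mul_cancel₀ (pow_ne_zero j ξ.ne_zero), one_smul]
  rw [generator, map_sum, Finset.sum_congr rfl fun j _ => h1 j, Finset.sum_const,
    Finset.card_range, Nat.cast_smul_eq_nsmul]

/-- Evaluation at the generator of `L_ξ`, as a linear map `Hom(L_ξ, F) → F(ℤ/nℤ)_ξ`. -/
def evalGenerator (F : Sh k) : (ξ.line ⟶ F) →ₗ[k] ξ.component F.obj where
  toFun φ := ⟨(φ.hom.app (op ξ.object)).hom ξ.lineGenerator,
    ξ.app_mem_component φ.hom ξ.lineGenerator_mem⟩
  map_add' _ _ := rfl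
  map_smul' _ _ := rfl

theorem evalGenerator_bijective [CharZero k] (F : Sh k) :
    Function.Bijective (ξ.evalGenerator F) := by
  constructor
  · intro φ ψ h
    exact Sheaf.hom_ext (ξ.presheaf_hom_ext (congrArg Subtype.val h))
  · rintro ⟨v, hv⟩
    have hn : (ξ.order : k) ≠ 0 := Nat.cast_ne_zero.2 ξ.order_pos.ne'
    refine ⟨ObjectProperty.homMk (ξ.presheafDesc F.obj ((ξ.order : k)⁻¹ • v)), Subtype.ext ?_⟩
    refine (ξ.presheafDesc_lineGenerator (Submodule.smul_mem _ _ hv)).trans ?_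
    rw [smul_smul, mul_inv_cancel₀ hn, one_smul]

/-- The functor `F ↦ F(ℤ/nℤ)_ξ` is isomorphic to `Hom(L_ξ, -)`. -/
def componentFunctorIso [CharZero k] :
    ξ.componentFunctor ≅ (linearCoyoneda k (Sh k)).obj (op ξ.line) :=
  (NatIso.ofComponents
    (fun F => (LinearEquiv.ofBijective _ (ξ.evalGenerator_bijective F)).toModuleIso)
    (fun _ => rfl)).symm

/-- The shift acts as `ζ` on the source and as `ξ` on the target. -/
theorem line_hom_eq_zero {ξ ζ : PrimRoot k} (h : ζ ≠ ξ) (φ : ζ.line ⟶ ξ.line) : φ = 0 := by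
  refine Sheaf.hom_ext (ζ.presheaf_hom_ext ?_)
  have h1 := (ζ.mem_component_iff _ _).1 (ζ.app_mem_component φ.hom ζ.lineGenerator_mem)
  have h2 := ξ.act_one_presheaf _ ((φ.hom.app (op ζ.object)).hom ζ.lineGenerator)
  have h3 : (ζ.root - ξ.root) • (φ.hom.app (op ζ.object)).hom ζ.lineGenerator = 0 := by
    rw [sub_smul, sub_eq_zero]
    exact h1.symm.trans h2
  exact (smul_eq_zero.1 h3).resolve_left fun h4 => h (Subtype.ext (sub_eq_zero.1 h4))

theorem line_end_eq_smul (φ : ξ.line ⟶ ξ.line) : ∃ c : k, φ = c • 𝟙 ξ.line := by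
  have h1 := ξ.app_mem_component φ.hom ξ.lineGenerator_mem
  have h2 : ((φ.hom.app (op ξ.object)).hom ξ.lineGenerator).1 ∈ ξ.eigenline := by
    rw [mem_eigenline_iff]
    exact congrArg Subtype.val ((ξ.mem_component_iff _ _).1 h1)
  obtain ⟨c, hc⟩ := ξ.exists_smul_generator h2
  exact ⟨c, Sheaf.hom_ext (ξ.presheaf_hom_ext (Subtype.ext hc))⟩

theorem id_line_ne_zero : 𝟙 ξ.line ≠ 0 := by
  intro h
  have h1 : ξ.lineGenerator = 0 :=
    congrArg (fun φ : ξ.line ⟶ ξ.line => (φ.hom.app (op ξ.object)).hom ξ.lineGenerator) h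
  have h2 := ξ.generator_apply_id
  have h3 : ξ.generator = 0 := congrArg Subtype.val h1
  rw [h3] at h2
  exact zero_ne_one h2

end PrimRoot

/-! ### Eigenspace decomposition -/

/-- An endomorphism of finite order is diagonalizable over an algebraically closed field of
characteristic `0`, also on an infinite-dimensional space. -/
theorem Module.End.iSup_eigenspace_eq_top_of_pow_eq_one {k M : Type*} [Field k] [IsAlgClosed k]
    [CharZero k] [AddCommGroup M] [Module k M] (T : Module.End k M) {m : ℕ} (hm : 0 < m)
    (hT : T ^ m = 1) : ⨆ c : k, Module.End.eigenspace T c = ⊤ := by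
  have : NeZero m := ⟨hm.ne'⟩
  have : NeZero (m : k) := ⟨Nat.cast_ne_zero.2 hm.ne'⟩
  obtain ⟨w, hw⟩ := HasEnoughRootsOfUnity.exists_primitiveRoot k m
  have hw0 : w ≠ 0 := hw.ne_zero hm.ne'
  rw [eq_top_iff]
  intro v _
  -- `u i` is `m` times the projection of `v` to the eigenspace of `w⁻ⁱ`.
  let u : ℕ → M := fun i => ∑ j ∈ Finset.range m, (w ^ i) ^ j • (T ^ j) v
  have hu : ∀ i, u i ∈ Module.End.eigenspace T (w ^ i)⁻¹ := by
    intro i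
    rw [Module.End.mem_eigenspace_iff, eq_inv_smul_iff₀ (pow_ne_zero i hw0)]
    simp only [u]
    rw [map_sum, Finset.smul_sum]
    refine Eq.trans (Finset.sum_congr rfl fun j _ => ?_) (sum_range_succ_eq_of_periodic
      (g := fun j => (w ^ i) ^ j • (T ^ j) v) (m := m) ?_)
    · rw [map_smul, smul_smul, ← pow_succ', pow_succ' T, Module.End.mul_apply]
    · simp only [hT, pow_zero, ← pow_mul, mul_comm i m, pow_mul w m, hw.pow_eq_one, one_pow]
  have hsum : ∑ i ∈ Finset.range m, u i = (m : k) • v := by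
    simp only [u]
    rw [Finset.sum_comm, Finset.sum_eq_single 0]
    · simp [Nat.cast_smul_eq_nsmul]
    · intro j hj hj0
      have hne : w ^ j ≠ 1 := hw.pow_ne_one_of_pos_of_lt hj0 (Finset.mem_range.1 hj)
      have h1 := geom_sum_mul (w ^ j) m
      rw [← pow_mul, mul_comm j m, pow_mul, hw.pow_eq_one, one_pow, sub_self] at h1
      have h2 := (mul_eq_zero.1 h1).resolve_right (sub_ne_zero.2 hne)
      rw [← Finset.sum_smul]
      simp only [← pow_mul, mul_comm _ j] at h2 ⊢
      rw [h2, zero_smul]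
    · intro h
      exact absurd (Finset.mem_range.2 hm) h
  have h3 : ∑ i ∈ Finset.range m, u i ∈ ⨆ c : k, Module.End.eigenspace T c :=
    Submodule.sum_mem _ fun i _ => Submodule.mem_iSup_of_mem _ (hu i)
  rw [hsum] at h3
  have h4 := Submodule.smul_mem _ (m : k)⁻¹ h3
  rwa [smul_smul, inv_mul_cancel₀ (NeZero.ne _), one_smul] at h4

namespace IntOrbit

open PrimRoot

variable {k : Type u} [Field k]

theorem act_one_pow (F : IntOrbitᵒᵖ ⥤ ModuleCat.{u} k) {X : IntOrbit} (j : ℕ)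
    (x : F.obj (op X)) :
    ((act F (le_refl X.subgroup) 1 : Module.End k (F.obj (op X))) ^ j) x =
      act F (le_refl X.subgroup) j x := by
  induction j with
  | zero => rw [Nat.cast_zero, act_zero]; rfl
  | succ j ih =>
    rw [pow_succ', Module.End.mul_apply, ih, act_act, Nat.cast_succ, add_comm]

theorem iSup_eigenspace_act [IsAlgClosed k] [CharZero k] (F : IntOrbitᵒᵖ ⥤ ModuleCat.{u} k)
    (X : IntOrbit) :
    ⨆ c : k, Module.End.eigenspace (act F (le_refl X.subgroup) 1) c = ⊤ := by
  obtain ⟨m, hm, hX⟩ := exists_subgroup_eq X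
  refine Module.End.iSup_eigenspace_eq_top_of_pow_eq_one _ hm ?_
  ext x
  rw [act_one_pow, act_self]
  · rfl
  · rw [hX]
    exact AddSubgroup.mem_zmultiples _

/-- The eigenvalues of the shift on `F(ℤ/H)` are roots of unity, of order `n` with `H ≤ nℤ`. -/
theorem exists_primRoot_of_eigenvector (F : IntOrbitᵒᵖ ⥤ ModuleCat.{u} k) {X : IntOrbit} {c : k}
    {x : F.obj (op X)} (hx0 : x ≠ 0) (hx : act F (le_refl X.subgroup) 1 x = c • x) :
    ∃ ξ : PrimRoot k, ξ.root = c ∧ X.subgroup ≤ ξ.object.subgroup := by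
  obtain ⟨m, hm, hX⟩ := exists_subgroup_eq X
  have hpow : ∀ j : ℕ, act F (le_refl X.subgroup) j x = c ^ j • x := by
    intro j
    induction j with
    | zero => rw [Nat.cast_zero, act_zero, pow_zero, one_smul]
    | succ j ih =>
      rw [Nat.cast_succ, ← act_act F (le_refl X.subgroup) (le_refl X.subgroup), hx, map_smul, ih,
        smul_smul, pow_succ']
  have h1 := hpow m
  rw [act_self F (by rw [hX]; exact AddSubgroup.mem_zmultiples _)] at h1
  have h2 : (c ^ m - 1) • x = 0 := by rw [sub_smul, one_smul, ← h1, sub_self]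
  have h3 : c ^ m = 1 := sub_eq_zero.1 ((smul_eq_zero.1 h2).resolve_right hx0)
  refine ⟨⟨c, orderOf c, orderOf_pos_iff.2 (isOfFinOrder_iff_pow_eq_one.2 ⟨m, hm, h3⟩),
    IsPrimitiveRoot.orderOf c⟩, rfl, ?_⟩
  exact le_object_of_eigenvector F _ hx0 hx fun a ha => act_self F ha x

/-! ### The sheaf with prescribed components -/

section

variable (V : PrimRoot k → ModuleCat.{u} k)

/-- The automorphism of `⨁ V ξ` that multiplies `V ξ` by `ξ ^ a`. -/
def scale (a : ℤ) : (Π₀ ξ, V ξ) →ₗ[k] Π₀ ξ, V ξ :=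
  DFinsupp.mapRange.linearMap fun ξ => (ξ.root ^ a) • LinearMap.id

theorem scale_apply (a : ℤ) (v : Π₀ ξ, V ξ) (ξ : PrimRoot k) :
    scale V a v ξ = ξ.root ^ a • v ξ :=
  rfl

/-- The part of `⨁ V ξ` that is fixed by `H`, where `ℤ/H` is the orbit `X`: the sum over the `ξ`
with `ξ ^ a = 1` for all `a ∈ H`. -/
def fixedPart (X : IntOrbit) : Submodule k (Π₀ ξ, V ξ) where
  carrier := {v | ∀ ξ : PrimRoot k, ¬ X.subgroup ≤ ξ.object.subgroup → v ξ = 0}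
  add_mem' {v w} hv hw ξ hξ := by rw [DFinsupp.add_apply, hv ξ hξ, hw ξ hξ, add_zero]
  zero_mem' ξ _ := rfl
  smul_mem' c v hv ξ hξ := by rw [DFinsupp.smul_apply, hv ξ hξ, smul_zero]

theorem fixedPart_mono {X Y : IntOrbit} (h : X.subgroup ≤ Y.subgroup) :
    fixedPart V Y ≤ fixedPart V X :=
  fun _ hv ξ hξ => hv ξ fun hY => hξ (h.trans hY)

theorem scale_mem {X : IntOrbit} (a : ℤ) {v : Π₀ ξ, V ξ} (hv : v ∈ fixedPart V X) :
    scale V a v ∈ fixedPart V X := by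
  intro ξ hξ
  rw [scale_apply, hv ξ hξ, smul_zero]

theorem scale_congr {X : IntOrbit} {a b : ℤ} (hab : b - a ∈ X.subgroup) {v : Π₀ ξ, V ξ}
    (hv : v ∈ fixedPart V X) : scale V a v = scale V b v := by
  ext ξ
  rw [scale_apply, scale_apply]
  by_cases hξ : X.subgroup ≤ ξ.object.subgroup
  · have h1 := (ξ.mem_object_iff _).1 (hξ hab)
    rw [← sub_add_cancel b a, zpow_add₀ ξ.ne_zero, h1, one_mul]
  · rw [hv ξ hξ, smul_zero, smul_zero]

theorem scale_scale (a b : ℤ) (v : Π₀ ξ, V ξ) : scale V a (scale V b v) = scale V (a + b) v := by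
  ext ξ
  rw [scale_apply, scale_apply, scale_apply, smul_smul, zpow_add₀ ξ.ne_zero]

theorem scale_zero (v : Π₀ ξ, V ξ) : scale V 0 v = v := by
  ext ξ
  rw [scale_apply, zpow_zero, one_smul]

/-- The presheaf on orbits whose value on `ℤ/H` is the part of `⨁ V ξ` fixed by `H`, with
`x ↦ x + a` acting on `V ξ` as `ξ ^ a`. -/
def assemblePresheaf : IntOrbitᵒᵖ ⥤ ModuleCat.{u} k where
  obj X := ModuleCat.of k (fixedPart V (unop X))
  map {Y X} f := ModuleCat.ofHom ((scale V (offset f.unop)).restrict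
    fun _ hv => scale_mem V _ (fixedPart_mono V (le_of_hom f.unop) hv))
  map_id X := by
    ext1
    refine LinearMap.ext fun v => Subtype.ext ?_
    change scale V _ v.1 = v.1
    rw [scale_congr V (b := 0) ?_ v.2, scale_zero]
    rw [← homOfLE_eq_iff (le_refl (unop X).subgroup), homOfLE_zero]
    exact homOfLE_offset _
  map_comp {Z Y X} f g := by
    ext1
    refine LinearMap.ext fun v => Subtype.ext ?_
    change scale V _ v.1 = scale V _ (scale V _ v.1)
    rw [scale_scale]
    refine scale_congr V ?_ v.2
    rw [← homOfLE_eq_iff (le_of_hom (f ≫ g).unop), homOfLE_offset,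
      ← homOfLE_comp (le_of_hom g.unop) (le_of_hom f.unop), homOfLE_offset, homOfLE_offset]
    rfl

theorem act_assemble {X Y : IntOrbit} (h : X.subgroup ≤ Y.subgroup) (a : ℤ)
    (v : (assemblePresheaf V).obj (op Y)) :
    (act (assemblePresheaf V) h a v).1 = scale V a v.1 := by
  change scale V _ v.1 = scale V a v.1
  refine scale_congr V ?_ v.2
  rw [← homOfLE_eq_iff h]
  exact homOfLE_offset (homOfLE h a)

theorem isSheaf_assemble : Presheaf.IsSheaf atomicTopology (assemblePresheaf V) := by
  rw [isSheaf_iff]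
  intro X Y h
  have h0 : ∀ v, (act (assemblePresheaf V) h 0 v).1 = v.1 := fun v => by
    rw [act_assemble, scale_zero]
  refine ⟨fun v w hvw => Subtype.ext ?_, fun w hw => ?_⟩
  · rw [← h0 v, hvw, h0 w]
  · refine ⟨⟨w.1, fun ξ hξ => ?_⟩, Subtype.ext (h0 _)⟩
    by_contra hne
    refine hξ fun c hc => (ξ.mem_object_iff c).2 ?_
    have h1 : scale V c w.1 = w.1 :=
      (act_assemble V le_rfl c w).symm.trans (congrArg Subtype.val (hw c hc))
    have h2 := DFunLike.congr_fun h1 ξ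
    rw [scale_apply] at h2
    have h3 : (ξ.root ^ c - 1) • w.1 ξ = 0 := by rw [sub_smul, one_smul, h2, sub_self]
    exact sub_eq_zero.1 ((smul_eq_zero.1 h3).resolve_right hne)

end

/-- The functor that sends a family `V` to the sheaf with components `V ξ`. -/
def assemble : (PrimRoot k → ModuleCat.{u} k) ⥤ Sh k where
  obj V := ⟨assemblePresheaf V, isSheaf_assemble V⟩
  map {V W} α := ObjectProperty.homMk (homOfAct (F := assemblePresheaf V) (G := assemblePresheaf W)
    (fun X => (DFinsupp.mapRange.linearMap fun ξ => (α ξ).hom).restrict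
      (p := fixedPart V X) (q := fixedPart W X) fun v hv ξ hξ => by
        rw [DFinsupp.mapRange.linearMap_apply, DFinsupp.mapRange_apply, hv ξ hξ, map_zero])
    (fun X Y h a v => by
      apply Subtype.ext
      rw [act_assemble]
      ext ξ
      change (α ξ).hom ((act (assemblePresheaf V) h a v).1 ξ) = ξ.root ^ a • (α ξ).hom (v.1 ξ)
      rw [act_assemble, scale_apply, map_smul]))
  map_id V := by
    refine Sheaf.hom_ext ?_
    ext X v
    exact Subtype.ext (DFinsupp.ext fun _ => rfl)
  map_comp α β := by
    refine Sheaf.hom_ext ?_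
    ext X v
    exact Subtype.ext (DFinsupp.ext fun _ => rfl)

end IntOrbit

/-! ### The equivalence with families of modules -/

open Classical in
theorem DFinsupp.linearMap_apply_eq_of_single {R ι M : Type*} {β : ι → Type*} [Semiring R]
    [∀ i, AddCommMonoid (β i)] [∀ i, Module R (β i)] [AddCommMonoid M] [Module R M]
    (A B : (Π₀ i, β i) →ₗ[R] M) (v : Π₀ i, β i)
    (h : ∀ i, v i ≠ 0 → A (DFinsupp.single i (v i)) = B (DFinsupp.single i (v i))) :
    A v = B v := by
  rw [← DFinsupp.sum_single (f := v), DFinsupp.sum, map_sum, map_sum]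
  exact Finset.sum_congr rfl fun i hi => h i (DFinsupp.mem_support_iff.1 hi)

namespace IntOrbit

open PrimRoot

variable {k : Type u} [Field k]

open Classical in
/-- The restriction map `F(ℤ/nℤ)_ξ → F(ℤ/H)` along the projection `ℤ/H → ℤ/nℤ`, and zero if
`H` is not contained in `nℤ`. -/
def componentRes (F : IntOrbitᵒᵖ ⥤ ModuleCat.{u} k) (X : IntOrbit) (ξ : PrimRoot k) :
    ξ.component F →ₗ[k] F.obj (op X) :=
  if h : X.subgroup ≤ ξ.object.subgroup then act F h 0 ∘ₗ (ξ.component F).subtype else 0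

theorem componentRes_apply (F : IntOrbitᵒᵖ ⥤ ModuleCat.{u} k) {X : IntOrbit} {ξ : PrimRoot k}
    (h : X.subgroup ≤ ξ.object.subgroup) (v : ξ.component F) :
    componentRes F X ξ v = act F h 0 v.1 := by
  rw [componentRes, dif_pos h]
  rfl

theorem componentRes_mem (F : IntOrbitᵒᵖ ⥤ ModuleCat.{u} k) (X : IntOrbit) (ξ : PrimRoot k)
    (v : ξ.component F) :
    componentRes F X ξ v ∈ Module.End.eigenspace (act F (le_refl X.subgroup) 1) ξ.root := by
  rw [Module.End.mem_eigenspace_iff]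
  by_cases h : X.subgroup ≤ ξ.object.subgroup
  · rw [componentRes_apply F h, act_act, ← map_smul, ← (ξ.mem_component_iff F _).1 v.2, act_act,
      add_comm]
  · rw [componentRes, dif_neg h, LinearMap.zero_apply, map_zero, smul_zero]

open Classical in
/-- The sum of the restriction maps `F(ℤ/nℤ)_ξ → F(ℤ/H)` over all `ξ`. -/
def componentSum (F : IntOrbitᵒᵖ ⥤ ModuleCat.{u} k) (X : IntOrbit) :
    (Π₀ ξ : PrimRoot k, ξ.component F) →ₗ[k] F.obj (op X) :=
  DFinsupp.lsum k fun ξ => componentRes F X ξ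

open Classical in
theorem componentSum_single (F : IntOrbitᵒᵖ ⥤ ModuleCat.{u} k) (X : IntOrbit) (ξ : PrimRoot k)
    (v : ξ.component F) :
    componentSum F X (DFinsupp.single ξ v) = componentRes F X ξ v := by
  rw [componentSum, DFinsupp.lsum_single]

/-- The family of the components of a sheaf. -/
abbrev components (F : Sh k) (ξ : PrimRoot k) : ModuleCat.{u} k := ξ.componentFunctor.obj F

theorem componentSum_scale (F : Sh k) {X Y : IntOrbit} (h : X.subgroup ≤ Y.subgroup) (a : ℤ)
    {v : Π₀ ξ, components F ξ} (hv : v ∈ fixedPart (components F) Y) :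
    componentSum F.obj X (scale (components F) a v) = act F.obj h a (componentSum F.obj Y v) := by
  classical
  refine DFinsupp.linearMap_apply_eq_of_single (componentSum F.obj X ∘ₗ scale (components F) a)
    (act F.obj h a ∘ₗ componentSum F.obj Y) v fun ξ hξ => ?_
  have hY : Y.subgroup ≤ ξ.object.subgroup := by
    by_contra hY
    exact hξ (hv ξ hY)
  have h1 : scale (components F) a (DFinsupp.single ξ (v ξ)) =
      DFinsupp.single ξ (ξ.root ^ a • v ξ) :=
    DFinsupp.mapRange_single (hf := fun _ => map_zero _)
  refine (congrArg (componentSum F.obj X) h1).trans ((componentSum_single _ _ _ _).trans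
    (Eq.trans ?_ (congrArg (act F.obj h a) (componentSum_single _ _ _ _).symm)))
  refine (componentRes_apply F.obj (h.trans hY) _).trans
    (Eq.trans ?_ (congrArg (act F.obj h a) (componentRes_apply F.obj hY (v ξ)).symm))
  obtain ⟨y, hy⟩ : ξ.component F.obj := v ξ
  change act F.obj _ 0 (ξ.root ^ a • y) = act F.obj h a (act F.obj hY 0 y)
  rw [← act_eigenvector F.obj ξ.ne_zero ((ξ.mem_component_iff F.obj _).1 hy), act_act, act_act,
    zero_add, add_zero]

/-- The canonical morphism to `F` from the sheaf assembled from the components of `F`. -/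
def assembleDesc (F : Sh k) : assemble.{u}.obj (components F) ⟶ F :=
  ObjectProperty.homMk (homOfAct (F := assemblePresheaf (components F)) (G := F.obj)
    (fun X => componentSum F.obj X ∘ₗ (fixedPart (components F) X).subtype)
    (fun X Y h a v => by
      change componentSum F.obj X (act (assemblePresheaf (components F)) h a v).1 = _
      rw [act_assemble]
      exact componentSum_scale F h a v.2))

theorem root_injective : Function.Injective (root : PrimRoot k → k) := Subtype.val_injective

/-- Eigenspaces for different eigenvalues are independent, and restriction maps of a sheaf are
injective. -/
theorem componentSum_injective (F : Sh k) (X : IntOrbit) {v : Π₀ ξ, components F ξ}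
    (hv : v ∈ fixedPart (components F) X) (h0 : componentSum F.obj X v = 0) : v = 0 := by
  classical
  let T : Module.End k (F.obj.obj (op X)) := act F.obj (le_refl X.subgroup) 1
  have hind : iSupIndep fun ξ : PrimRoot k => Module.End.eigenspace T ξ.root :=
    T.eigenspaces_iSupIndep.comp root_injective
  let w : Π₀ ξ : PrimRoot k, Module.End.eigenspace T ξ.root :=
    DFinsupp.mapRange.linearMap (fun ξ => (componentRes F.obj X ξ).codRestrict _
      (componentRes_mem F.obj X ξ)) v
  have hw : w = 0 := by
    refine hind.dfinsupp_lsum_injective (R := k) ?_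
    rw [map_zero, ← h0]
    refine DFinsupp.linearMap_apply_eq_of_single
      (DFinsupp.lsum k (fun ξ : PrimRoot k => (Module.End.eigenspace T ξ.root).subtype) ∘ₗ
        DFinsupp.mapRange.linearMap (fun ξ => (componentRes F.obj X ξ).codRestrict _
          (componentRes_mem F.obj X ξ))) (componentSum F.obj X) v fun ξ _ => ?_
    refine Eq.trans ?_ (componentSum_single _ _ _ _).symm
    rw [LinearMap.comp_apply, DFinsupp.mapRange.linearMap_apply, DFinsupp.mapRange_single,
      DFinsupp.lsum_single]
    rfl
  refine DFinsupp.ext fun ξ => ?_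
  by_cases hξ : X.subgroup ≤ ξ.object.subgroup
  · have h1 : componentRes F.obj X ξ (v ξ) = 0 :=
      congrArg Subtype.val (DFunLike.congr_fun hw ξ)
    have h2 := (componentRes_apply F.obj hξ _).symm.trans h1
    exact Subtype.ext
      (((isSheaf_iff F.obj).1 F.property X ξ.object hξ).1 (h2.trans (map_zero _).symm))
  · exact hv ξ hξ

/-- The eigenspaces of the shift span `F(ℤ/H)`, and an eigenvector with eigenvalue `ξ` of order `n`
is fixed by `nℤ`, hence is the restriction of an element of the `ξ`-component. -/
theorem componentSum_surjective [IsAlgClosed k] [CharZero k] (F : Sh k) (X : IntOrbit) :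
    (fixedPart (components F) X).map (componentSum F.obj X) = ⊤ := by
  classical
  rw [eq_top_iff, ← iSup_eigenspace_act F.obj X]
  refine iSup_le fun c x hx => ?_
  rw [Module.End.mem_eigenspace_iff] at hx
  by_cases hx0 : x = 0
  · rw [hx0]
    exact Submodule.zero_mem _
  obtain ⟨ξ, rfl, hX⟩ := exists_primRoot_of_eigenvector F.obj hx0 hx
  obtain ⟨hinj, hdesc⟩ := (isSheaf_iff F.obj).1 F.property X ξ.object hX
  obtain ⟨y, hy⟩ := hdesc x fun c hc => by
    rw [act_eigenvector F.obj ξ.ne_zero hx, (ξ.mem_object_iff c).1 hc, one_smul]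
  have hyc : y ∈ ξ.component F.obj := by
    rw [mem_component_iff]
    apply hinj
    rw [act_act, map_smul, hy, ← hx, ← hy, act_act, add_comm]
  refine ⟨DFinsupp.single ξ ⟨y, hyc⟩, fun ζ hζ => ?_, ?_⟩
  · refine DFinsupp.single_eq_of_ne ?_
    rintro rfl
    exact hζ hX
  · exact (componentSum_single _ _ _ _).trans ((componentRes_apply F.obj hX _).trans hy)

theorem isIso_assembleDesc [IsAlgClosed k] [CharZero k] (F : Sh k) : IsIso (assembleDesc F) := by
  have h1 : ∀ X, IsIso ((assembleDesc F).hom.app X) := by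
    intro X
    rw [ConcreteCategory.isIso_iff_bijective]
    constructor
    · refine (injective_iff_map_eq_zero ((assembleDesc F).hom.app X).hom).2 fun v hv => ?_
      exact Subtype.ext (componentSum_injective F (unop X) v.2 hv)
    · intro x
      have hx : x ∈ (fixedPart (components F) (unop X)).map (componentSum F.obj (unop X)) := by
        rw [componentSum_surjective]
        trivial
      obtain ⟨v, hv, hvx⟩ := hx
      exact ⟨⟨v, hv⟩, hvx⟩
  have h2 : IsIso (assembleDesc F).hom := NatIso.isIso_of_isIso_app _
  exact (isIso_iff_of_reflects_iso (assembleDesc F) (sheafToPresheaf _ _)).1 h2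

/-- The functor that sends a sheaf to the family of its components. -/
def componentsFunctor : Sh k ⥤ (PrimRoot k → ModuleCat.{u} k) :=
  Functor.pi' fun ξ => ξ.componentFunctor

/-- A sheaf is assembled from its components. -/
def assembleComponentsIso [IsAlgClosed k] [CharZero k] :
    componentsFunctor ⋙ assemble.{u} ≅ 𝟭 (Sh k) :=
  NatIso.ofComponents (fun F =>
    @asIso _ _ _ _ (assembleDesc F) (isIso_assembleDesc F)) (fun {F G} φ => by
    classical
    refine Sheaf.hom_ext ?_
    ext X v
    refine DFinsupp.linearMap_apply_eq_of_single
      (componentSum G.obj (unop X) ∘ₗ DFinsupp.mapRange.linearMap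
        fun ξ : PrimRoot k => (ξ.componentFunctor.map φ).hom)
      ((φ.hom.app X).hom ∘ₗ componentSum F.obj (unop X)) v.1 fun ξ hξ => ?_
    have hX : (unop X).subgroup ≤ ξ.object.subgroup := by
      by_contra hX
      exact hξ (v.2 ξ hX)
    refine (congrArg (componentSum G.obj (unop X))
      (DFinsupp.mapRange_single (hf := fun _ => map_zero _))).trans ?_
    refine (componentSum_single _ _ _ _).trans
      (Eq.trans ?_ (congrArg (φ.hom.app X).hom (componentSum_single _ _ _ _).symm))
    refine (componentRes_apply G.obj hX _).trans
      (Eq.trans ?_ (congrArg (φ.hom.app X).hom (componentRes_apply F.obj hX _).symm))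
    exact (app_act φ.hom hX 0 _).symm)

section

variable (V : PrimRoot k → ModuleCat.{u} k) (ξ : PrimRoot k)

/-- The projection from the `ξ`-component of the sheaf assembled from `V` to `V ξ`. -/
def componentAssemble : ξ.component (assemblePresheaf V) →ₗ[k] V ξ where
  toFun x := x.1.1 ξ
  map_add' _ _ := rfl
  map_smul' _ _ := rfl

theorem component_assemble_apply_eq_zero (x : ξ.component (assemblePresheaf V)) {ζ : PrimRoot k}
    (h : ζ ≠ ξ) : x.1.1 ζ = 0 := by
  have h1 := congrArg Subtype.val ((ξ.mem_component_iff _ _).1 x.2)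
  rw [act_assemble] at h1
  have h2 : ζ.root ^ (1 : ℤ) • x.1.1 ζ = ξ.root • x.1.1 ζ := DFunLike.congr_fun h1 ζ
  rw [zpow_one, ← sub_eq_zero, ← sub_smul] at h2
  exact (smul_eq_zero.1 h2).resolve_left fun h3 => h (root_injective (sub_eq_zero.1 h3))

theorem componentAssemble_bijective : Function.Bijective (componentAssemble V ξ) := by
  classical
  constructor
  · refine (injective_iff_map_eq_zero _).2 fun x hx => Subtype.ext (Subtype.ext ?_)
    refine DFinsupp.ext fun ζ => ?_
    by_cases h : ζ = ξ
    · rw [h]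
      exact hx
    · exact component_assemble_apply_eq_zero V ξ x h
  · intro v
    have hv : DFinsupp.single ξ v ∈ fixedPart V ξ.object := by
      intro ζ hζ
      refine DFinsupp.single_eq_of_ne ?_
      rintro rfl
      exact hζ le_rfl
    refine ⟨⟨⟨DFinsupp.single ξ v, hv⟩, (ξ.mem_component_iff _ _).2 (Subtype.ext ?_)⟩,
      DFinsupp.single_eq_same (β := fun ξ => V ξ)⟩
    refine (act_assemble V le_rfl 1 _).trans ?_
    refine (DFinsupp.mapRange_single (hf := fun _ => map_zero _)).trans ?_
    rw [zpow_one]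
    exact DFinsupp.single_smul _ _

end

/-- The components of the sheaf assembled from `V` are the modules `V ξ`. -/
def componentsAssembleIso :
    assemble.{u} ⋙ componentsFunctor ≅ 𝟭 (PrimRoot k → ModuleCat.{u} k) :=
  NatIso.ofComponents (fun V => Pi.isoMk fun ξ =>
    (LinearEquiv.ofBijective _ (componentAssemble_bijective V ξ)).toModuleIso) (fun _ => rfl)

/-- A sheaf is the same as the family of its components. -/
def componentsEquivalence [IsAlgClosed k] [CharZero k] :
    Sh k ≌ (PrimRoot k → ModuleCat.{u} k) :=
  CategoryTheory.Equivalence.mk componentsFunctor assemble.{u} assembleComponentsIso.symm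
    componentsAssembleIso

end IntOrbit

/-! ### Categories that are products of categories of modules -/

namespace CategoryTheory

theorem NatIso.map_eq_conj_iff {C D : Type*} [Category* C] [Category* D] {F G : C ⥤ D}
    (α : F ≅ G) {V W : C} (f : V ⟶ W) (g : G.obj V ⟶ G.obj W) :
    F.map f = α.hom.app V ≫ g ≫ α.inv.app W ↔ G.map f = g := by
  have h : F.map f = α.hom.app V ≫ G.map f ≫ α.inv.app W := by simp
  rw [h, cancel_epi, cancel_mono]

variable {k : Type u} [Field k] {C : Type v} [Category.{u} C] [Preadditive C] [Linear k C]
  {I : Type u} {L : I → C} (e : C ≌ (I → ModuleCat.{u} k))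
  (he : ∀ i, e.functor ⋙ Pi.eval (fun _ : I => ModuleCat.{u} k) i ≅
    (linearCoyoneda k C).obj (op (L i)))

include he

/-- A morphism `V ⟶ W` may be prescribed, uniquely, by linear maps `Hom(L i, V) → Hom(L i, W)`. -/
theorem existsUnique_hom_of_components {V W : C} (a : ∀ i, (L i ⟶ V) →ₗ[k] (L i ⟶ W)) :
    ∃! d : V ⟶ W, ∀ i (g : L i ⟶ V), g ≫ d = a i g := by
  let m : e.functor.obj V ⟶ e.functor.obj W := fun i =>
    (he i).hom.app V ≫ ModuleCat.ofHom (a i) ≫ (he i).inv.app W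
  have key : ∀ d : V ⟶ W, (∀ i (g : L i ⟶ V), g ≫ d = a i g) ↔ e.functor.map d = m := by
    intro d
    rw [funext_iff]
    refine forall_congr' fun i => Iff.trans ?_ (NatIso.map_eq_conj_iff (he i) d _).symm
    constructor
    · intro h
      ext g
      exact h g
    · intro h g
      exact congrArg (fun q => q.hom g) h
  refine ⟨e.functor.preimage m, (key _).2 (e.functor.map_preimage m), fun d hd => ?_⟩
  apply e.functor.map_injective
  rw [(key d).1 hd, e.functor.map_preimage]

theorem exists_comp_ne_zero {V W : C} {f : V ⟶ W} (hf : f ≠ 0) :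
    ∃ (i : I) (g : L i ⟶ V), g ≫ f ≠ 0 := by
  by_contra! h
  exact hf ((existsUnique_hom_of_components e he fun _ => 0).unique h fun _ _ => comp_zero)

/-- A nonzero monomorphism `f` into `L i` receives a map from some `L j` with nonzero composite;
orthogonality forces `j = i`, and since `L i` has scalar endomorphisms, `f` splits. -/
theorem simple_of_components (h0 : ∀ i j, i ≠ j → ∀ φ : L i ⟶ L j, φ = 0)
    (h1 : ∀ i (φ : L i ⟶ L i), ∃ c : k, φ = c • 𝟙 (L i)) (h2 : ∀ i, 𝟙 (L i) ≠ 0) (i : I) :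
    Simple (L i) where
  mono_isIso_iff_nonzero {Y} f _ := by
    constructor
    · rintro hf rfl
      apply h2 i
      rw [← IsIso.inv_hom_id (0 : Y ⟶ L i), comp_zero]
    · intro hf
      obtain ⟨j, g, hg⟩ := exists_comp_ne_zero e he hf
      obtain rfl : j = i := by
        by_contra hji
        exact hg (h0 j i hji _)
      obtain ⟨c, hc⟩ := h1 j (g ≫ f)
      have hc0 : c ≠ 0 := by
        rintro rfl
        exact hg (hc.trans (zero_smul _ _))
      have : IsSplitEpi f := ⟨⟨⟨c⁻¹ • g, by
        rw [Linear.smul_comp, hc, smul_smul, inv_mul_cancel₀ hc0, one_smul]⟩⟩⟩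
      exact isIso_of_mono_of_isSplitEpi f

theorem existsUnique_iso_of_simple [HasKernels C]
    (h0 : ∀ i j, i ≠ j → ∀ φ : L i ⟶ L j, φ = 0) (hL : ∀ i, Simple (L i)) (S : C) [Simple S] :
    ∃! i, Nonempty (S ≅ L i) := by
  obtain ⟨i, g, hg⟩ := exists_comp_ne_zero e he (id_nonzero S)
  rw [Category.comp_id] at hg
  have := hL i
  have := isIso_of_hom_simple hg
  refine ⟨i, ⟨(asIso g).symm⟩, ?_⟩
  rintro j ⟨φ⟩
  by_contra hji
  apply id_nonzero S
  have h := h0 i j (Ne.symm hji) (g ≫ φ.hom)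
  rw [← cancel_mono φ.hom, ← cancel_epi g]
  simpa using h

/-- Bases of the spaces `Hom(L i, V)` exhibit `V` as a direct sum of copies of the `L i`. -/
theorem exists_isDirectSum (V : C) :
    ∃ (ι : Type u) (s : ι → I), IsDirectSum V fun x => L (s x) := by
  let b : ∀ i, Module.Basis (Module.Basis.ofVectorSpaceIndex k (L i ⟶ V)) k (L i ⟶ V) :=
    fun i => Module.Basis.ofVectorSpace k (L i ⟶ V)
  refine ⟨Σ i, Module.Basis.ofVectorSpaceIndex k (L i ⟶ V), Sigma.fst, fun x => b x.1 x.2, ⟨?_⟩⟩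
  -- A linear map out of `Hom(L i, V)` may be prescribed on the basis.
  have h := fun {W : C}
    (t : ∀ x : Σ i, Module.Basis.ofVectorSpaceIndex k (L i ⟶ V), L x.1 ⟶ W) =>
    existsUnique_hom_of_components e he fun i => (b i).constr k fun y => t ⟨i, y⟩
  refine Cofan.IsColimit.mk _ (fun s => (h s.inj).choose) (fun s x => ?_) (fun s d hd => ?_)
  · refine ((h s.inj).choose_spec.1 x.1 (b x.1 x.2)).trans ?_
    exact Module.Basis.constr_basis _ _ _ _
  · refine (h s.inj).choose_spec.2 d fun i g => ?_
    have heq : Linear.rightComp k (L i) d = (b i).constr k fun y => s.inj ⟨i, y⟩ :=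
      (b i).ext fun y => by
        rw [Module.Basis.constr_basis]
        exact hd ⟨i, y⟩
    exact LinearMap.congr_fun heq g

end CategoryTheory

end

theorem theorem1p4 (k : Type u) [Field k] [IsAlgClosed k] [CharZero k] :
    IsSemisimpleCategory (IntOrbit.Sh k) ∧
    ∃ hL : ∀ ξ : PrimRoot k, Presheaf.IsSheaf IntOrbit.atomicTopology ξ.presheaf,
      (∀ ξ : PrimRoot k, Simple (ξ.sheaf (hL ξ))) ∧
      (∀ S : IntOrbit.Sh k, Simple S → ∃! ξ : PrimRoot k, Nonempty (S ≅ ξ.sheaf (hL ξ))) ∧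
      (∀ V : IntOrbit.Sh k, ∃ (ι : Type u) (ξ : ι → PrimRoot k),
        IsDirectSum V fun i => (ξ i).sheaf (hL (ξ i))) ∧
      ∃ e : IntOrbit.Sh k ≌ (PrimRoot k → ModuleCat.{u} k),
        ∀ ξ : PrimRoot k,
          Nonempty (e.functor ⋙ Pi.eval (fun _ : PrimRoot k => ModuleCat.{u} k) ξ ≅
            (linearCoyoneda k (IntOrbit.Sh k)).obj (op (ξ.sheaf (hL ξ)))) := by
  let e : IntOrbit.Sh k ≌ (PrimRoot k → ModuleCat.{u} k) := IntOrbit.componentsEquivalence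
  have he : ∀ ξ : PrimRoot k, e.functor ⋙ Pi.eval (fun _ : PrimRoot k => ModuleCat.{u} k) ξ ≅
      (linearCoyoneda k (IntOrbit.Sh k)).obj (op ξ.line) := fun ξ =>
    Functor.pi'CompEval (fun ξ : PrimRoot k => ξ.componentFunctor) ξ ≪≫ ξ.componentFunctorIso
  have h0 : ∀ ζ ξ : PrimRoot k, ζ ≠ ξ → ∀ φ : ζ.line ⟶ ξ.line, φ = 0 :=
    fun _ _ h φ => PrimRoot.line_hom_eq_zero h φ
  have hsimple : ∀ ξ : PrimRoot k, Simple ξ.line := simple_of_components e he h0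
    (fun ξ φ => ξ.line_end_eq_smul φ) (fun ξ => ξ.id_line_ne_zero)
  refine ⟨fun V => ?_, fun ξ => ξ.isSheaf_presheaf, hsimple,
    fun S _ => existsUnique_iso_of_simple e he h0 hsimple S, exists_isDirectSum e he, e,
    fun ξ => ⟨he ξ⟩⟩
  obtain ⟨ι, ξ, h⟩ := exists_isDirectSum e he V
  exact ⟨ι, fun i => (ξ i).line, fun i => hsimple (ξ i), h⟩
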